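/- Let $\Omega$ be a Polish space and let $C_b(\Omega)$ be the space of bounded continuous functions $f:\Omega\to\mathbb{R}$ with the sup-norm. Let $\tau_c$ be the compact-open topology on $C_b(\Omega)$, generated by the seminorms $p_K(f)=\sup_{x\in K}|f(x)|$, $K\subseteq\Omega$ compact, and let $\beta_0$ be the strict (mixed) topology, generated by the seminorms $f\mapsto\sup_{n\in\mathbb{N}}a_n\,p_{K_n}(f)$, where $(K_n)$ runs over the sequences of compact subsets of $\Omega$ and $(a_n)$ over the nonnegative real null sequences. A semigroup is a family $(T(t))_{t\ge 0}$ of linear operators on $C_b(\Omega)$ with $T(0)=I$ and $T(s+t)=T(s)T(t)$; for a topology $\tau$, it is $\tau$-strongly continuous if $t\mapsto T(t)f$ is $\tau$-continuous on $[0,\infty)$ for each $f$. Let $\mathscr{F}$ be the set of $\tau_c$-strongly continuous semigroups $(T(t))_{t\ge0}$ on $C_b(\Omega)$ that are locally norm-bounded (for each $t_0\ge 0$, the $T(t)$ with $0\le t\le t_0$ are bounded operators and $\sup_{0\le t\le t_0}\|T(t)\|<\infty$) and for which each $T(t)$ is $\tau_c$-sequentially continuous on sup-norm bounded sets. Then both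 of the following classes coincide with $\mathscr{F}$: 1. the $\tau_c$-bi-continuous semigroups, i.e. the $\tau_c$-strongly continuous semigroups of bounded linear operators with $\sup_{0\le t\le 1}\|T(t)\|<\infty$ such that, for every norm-bounded sequence $(f_n)$ with $f_n\to0$ in $\tau_c$ and every $t_0\ge0$, $T(t)f_n\to0$ in $\tau_c$ uniformly for $t\in[0,t_0]$; 2. the $\beta_0$-strongly continuous, locally $\beta_0$-equicontinuous semigroups, i.e. those $\beta_0$-strongly continuous semigroups for which $\{T(t):0\le t\le t_0\}$ is $\beta_0$-equicontinuous for every $t_0\ge0$. -/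

import Mathlib

open scoped NNReal Topology BoundedContinuousFunction

/-- A one-parameter semigroup of linear operators on `X`, with time set `[0, ∞)`. -/
structure IsOperatorSemigroup {X : Type*} [AddCommGroup X] [Module ℝ X]
    (T : ℝ≥0 → X →ₗ[ℝ] X) : Prop where
  map_zero : T 0 = LinearMap.id
  map_add : ∀ s t : ℝ≥0, T (s + t) = T s ∘ₗ T t

/-- All orbits `t ↦ T(t) x` are continuous from `[0, ∞)` to `(X, τ)`. -/
def IsStronglyContinuous {X : Type*} [AddCommGroup X] [Module ℝ X]
    (τ : TopologicalSpace X) (T : ℝ≥0 → X →ₗ[ℝ] X) : Prop :=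
  ∀ x : X, @Continuous ℝ≥0 X _ τ (fun t => T t x)

/-- For `t` in a bounded interval the `T(t)` are bounded operators, with a common bound
for their operator norms. -/
def IsLocallyNormBounded {X : Type*} [NormedAddCommGroup X] [NormedSpace ℝ X]
    (T : ℝ≥0 → X →ₗ[ℝ] X) : Prop :=
  ∀ t₀ : ℝ≥0, ∃ M : ℝ, ∀ t ≤ t₀, ∀ x : X, ‖T t x‖ ≤ M * ‖x‖

/-- `S` is `τ`-sequentially continuous on norm-bounded sets: on every norm-bounded set `B`,
the restriction of `S` to `B` is sequentially continuous for the topology `τ`. -/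
def IsSeqContinuousOnBounded {X : Type*} [NormedAddCommGroup X] [NormedSpace ℝ X]
    (τ : TopologicalSpace X) (S : X →ₗ[ℝ] X) : Prop :=
  ∀ B : Set X, Bornology.IsBounded B → ∀ (u : ℕ → X) (x : X), (∀ n, u n ∈ B) → x ∈ B →
    Filter.Tendsto u Filter.atTop (@nhds X τ x) →
      Filter.Tendsto (fun n => S (u n)) Filter.atTop (@nhds X τ (S x))

/-- Local bi-equicontinuity: for every norm-bounded `τ`-null sequence `u`, the sequence
`T(t) (u n)` tends to `0` in `τ`, uniformly for `t` in compact intervals. -/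
def IsLocallyBiEquicontinuous {X : Type*} [NormedAddCommGroup X] [NormedSpace ℝ X]
    (τ : TopologicalSpace X) (T : ℝ≥0 → X →ₗ[ℝ] X) : Prop :=
  ∀ u : ℕ → X, Bornology.IsBounded (Set.range u) →
    Filter.Tendsto u Filter.atTop (@nhds X τ 0) →
      ∀ t₀ : ℝ≥0, ∀ U ∈ @nhds X τ 0, ∀ᶠ n in Filter.atTop, ∀ t ≤ t₀, T t (u n) ∈ U

/-- Local equicontinuity with respect to a (vector space) topology `τ`: for every `t₀` the
family of linear operators `{T(t) : t ≤ t₀}` is `τ`-equicontinuous. -/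
def IsLocallyEquicontinuous {X : Type*} [AddCommGroup X] [Module ℝ X]
    (τ : TopologicalSpace X) (T : ℝ≥0 → X →ₗ[ℝ] X) : Prop :=
  ∀ t₀ : ℝ≥0, ∀ U ∈ @nhds X τ 0, ∃ V ∈ @nhds X τ 0, ∀ t ≤ t₀, ∀ x ∈ V, T t x ∈ U

/-- `τ`-bi-continuous semigroups of bounded linear operators on a normed space `X`. -/
structure IsBiContinuousSemigroup {X : Type*} [NormedAddCommGroup X] [NormedSpace ℝ X]
    (τ : TopologicalSpace X) (T : ℝ≥0 → X →ₗ[ℝ] X) : Prop where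
  semigroup : IsOperatorSemigroup T
  bounded : ∀ t : ℝ≥0, ∃ M : ℝ, ∀ x : X, ‖T t x‖ ≤ M * ‖x‖
  stronglyContinuous : IsStronglyContinuous τ T
  bounded_unitInterval : ∃ M : ℝ, ∀ t ≤ (1 : ℝ≥0), ∀ x : X, ‖T t x‖ ≤ M * ‖x‖
  locallyBiEquicontinuous : IsLocallyBiEquicontinuous τ T

/-- The compact-open topology `τ_c` on the space of bounded continuous functions. -/
def tauC (Ω : Type*) [TopologicalSpace Ω] : TopologicalSpace (Ω →ᵇ ℝ) :=
  TopologicalSpace.induced BoundedContinuousFunction.toContinuousMap ContinuousMap.compactOpen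

/-- The seminorm `p_K(f) = sup_{x ∈ K} |f x|` (equal to `0` if `K` is empty). -/
noncomputable def supSeminorm {Ω : Type*} [TopologicalSpace Ω]
    (K : TopologicalSpace.Compacts Ω) : Seminorm ℝ (Ω →ᵇ ℝ) :=
  Seminorm.of (fun f => ⨆ x : K, |f x|)
    (by
      intro f g
      have hb : ∀ h : Ω →ᵇ ℝ, BddAbove (Set.range fun x : K => |h x|) := fun h =>
        ⟨‖h‖, by rintro _ ⟨x, rfl⟩; exact h.norm_coe_le_norm x⟩
      refine Real.iSup_le (fun x => ?_)
        (add_nonneg (Real.iSup_nonneg fun _ => abs_nonneg _)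
          (Real.iSup_nonneg fun _ => abs_nonneg _))
      exact (abs_add_le (f x) (g x)).trans
        (add_le_add (le_ciSup (hb f) x) (le_ciSup (hb g) x)))
    (by
      intro a f
      simp only [BoundedContinuousFunction.coe_smul, smul_eq_mul, abs_mul, Real.norm_eq_abs]
      exact (Real.mul_iSup_of_nonneg (abs_nonneg a) _).symm)

theorem supSeminorm_le_norm {Ω : Type*} [TopologicalSpace Ω]
    (K : TopologicalSpace.Compacts Ω) (f : Ω →ᵇ ℝ) : supSeminorm K f ≤ ‖f‖ :=
  Real.iSup_le (fun x => f.norm_coe_le_norm x) (norm_nonneg f)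

/-- Index set of the seminorms of the mixed topology: a sequence `(K n)` of compact sets and a
sequence `(a n)` of nonnegative reals tending to `0`. -/
def StrictIndex (Ω : Type*) [TopologicalSpace Ω] : Type _ :=
  { q : (ℕ → TopologicalSpace.Compacts Ω) × (ℕ → ℝ) //
    (∀ n, 0 ≤ q.2 n) ∧ Filter.Tendsto q.2 Filter.atTop (𝓝 0) }

instance (Ω : Type*) [TopologicalSpace Ω] : Nonempty (StrictIndex Ω) :=
  ⟨⟨(fun _ => ⊥, fun _ => 0), fun _ => le_rfl, tendsto_const_nhds⟩⟩

/-- The seminorm `f ↦ sup_n a_n p_{K_n}(f)`. -/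
noncomputable def strictSeminorm {Ω : Type*} [TopologicalSpace Ω] (q : StrictIndex Ω) :
    Seminorm ℝ (Ω →ᵇ ℝ) :=
  Seminorm.of (fun f => ⨆ n, q.1.2 n * supSeminorm (q.1.1 n) f)
    (by
      intro f g
      have hb : ∀ h : Ω →ᵇ ℝ,
          BddAbove (Set.range fun n => q.1.2 n * supSeminorm (q.1.1 n) h) := by
        intro h
        obtain ⟨C, hC⟩ := q.2.2.bddAbove_range
        refine ⟨C * ‖h‖, ?_⟩
        rintro _ ⟨n, rfl⟩
        have h1 : q.1.2 n ≤ C := hC ⟨n, rfl⟩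
        exact mul_le_mul h1 (supSeminorm_le_norm _ h) (apply_nonneg _ _)
          ((q.2.1 n).trans h1)
      refine ciSup_le fun n => ?_
      calc q.1.2 n * supSeminorm (q.1.1 n) (f + g)
          ≤ q.1.2 n * (supSeminorm (q.1.1 n) f + supSeminorm (q.1.1 n) g) :=
            mul_le_mul_of_nonneg_left (map_add_le_add _ _ _) (q.2.1 n)
        _ = q.1.2 n * supSeminorm (q.1.1 n) f + q.1.2 n * supSeminorm (q.1.1 n) g := mul_add _ _ _
        _ ≤ _ := add_le_add (le_ciSup (hb f) n) (le_ciSup (hb g) n))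
    (by
      intro a f
      simp only [map_smul_eq_mul]
      rw [Real.mul_iSup_of_nonneg (norm_nonneg a)]
      exact iSup_congr fun n => by ring)

/-- The strict (mixed) topology `β₀` on the space of bounded continuous functions: the locally
convex topology generated by all seminorms `sup_n a_n p_{K_n}`. -/
noncomputable def strictTopology (Ω : Type*) [TopologicalSpace Ω] : TopologicalSpace (Ω →ᵇ ℝ) :=
  (SeminormFamily.moduleFilterBasis
    (strictSeminorm : SeminormFamily ℝ (Ω →ᵇ ℝ) (StrictIndex Ω))).topology

/-- The `τ_c`-strongly continuous, locally norm-bounded semigroups of operators each of which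
is `τ_c`-sequentially continuous on sup-norm bounded sets. -/
def semigroupClassF (Ω : Type*) [TopologicalSpace Ω] :
    Set (ℝ≥0 → (Ω →ᵇ ℝ) →ₗ[ℝ] (Ω →ᵇ ℝ)) :=
  { T | IsOperatorSemigroup T ∧ IsLocallyNormBounded T ∧ IsStronglyContinuous (tauC Ω) T ∧
    ∀ t, IsSeqContinuousOnBounded (tauC Ω) (T t) }

/-! The substantial point is that membership in `semigroupClassF` forces `β₀`-equicontinuity on `[0,
t₀]`. A `β₀`-seminorm of `T t f` is a supremum of weighted values `a n * |T t f x|` with `x ∈ K n`,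
so it suffices to dominate the functionals `f ↦ T t f x` jointly by one strict seminorm. By Dini's
theorem, sequential continuity on bounded sets makes each functional `σ`-smooth. Strong continuity
makes `(t, x) ↦ T t f x` jointly continuous on `[0, t₀] × K`, so the family is sequentially compact
for pointwise convergence. A gliding hump argument (`tendsto_zero_of_dominated`) turns this into
uniform smoothness, which on a Polish space yields uniform tightness
(`isUniformlyTight_of_seqCompact`). Bounded uniformly tight families are dominated by a strict
seminorm (`IsUniformlyTight.exists_le_strictSeminorm`). Everything else rests on `τ_c` and `β₀`
having the same convergence on norm-bounded sets, and on `β₀`-equicontinuity forcing norm bounds. -/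

open Filter TopologicalSpace

/-! ### Smooth functionals and the gliding hump -/

section SigmaSmooth

variable {Ω : Type*} [TopologicalSpace Ω]

/-- The truncation of `f` to the order interval `[-φ, φ]`. -/
noncomputable def clip (f φ : Ω →ᵇ ℝ) : Ω →ᵇ ℝ := (f ⊓ φ) ⊔ (-φ)

theorem clip_apply (f φ : Ω →ᵇ ℝ) (x : Ω) :
    clip f φ x = max (min (f x) (φ x)) (-(φ x)) := rfl

theorem abs_clip_le (f : Ω →ᵇ ℝ) {φ : Ω →ᵇ ℝ} {x : Ω} (h : 0 ≤ φ x) :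
    |clip f φ x| ≤ φ x := by
  rw [clip_apply, abs_le]
  exact ⟨le_max_right _ _, max_le (min_le_right _ _) (by linarith)⟩

theorem clip_eq_self {f φ : Ω →ᵇ ℝ} {x : Ω} (h : |f x| ≤ φ x) : clip f φ x = f x := by
  rw [abs_le] at h
  rw [clip_apply, min_eq_left h.2, max_eq_left h.1]

theorem abs_sub_clip (f : Ω →ᵇ ℝ) {φ : Ω →ᵇ ℝ} {x : Ω} (h : 0 ≤ φ x) :
    |f x - clip f φ x| = max (|f x| - φ x) 0 := by
  rw [clip_apply]
  rcases le_total (|f x|) (φ x) with h1 | h1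
  · rw [max_eq_right (sub_nonpos.2 h1)]
    rw [abs_le] at h1
    rw [min_eq_left h1.2, max_eq_left h1.1, sub_self, abs_zero]
  · rw [max_eq_left (sub_nonneg.2 h1)]
    rcases le_total 0 (f x) with h2 | h2
    · rw [abs_of_nonneg h2] at *
      rw [min_eq_right h1, max_eq_left (by linarith), abs_of_nonneg (by linarith)]
    · rw [abs_of_nonpos h2] at *
      rw [min_eq_left (by linarith), max_eq_right (by linarith), abs_of_nonpos (by linarith)]
      ring

/-- A linear functional which is small along sequences dominated by a sequence decreasing
to zero pointwise. -/
def IsSigmaSmooth (Φ : (Ω →ᵇ ℝ) →ₗ[ℝ] ℝ) : Prop :=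
  ∀ φ g : ℕ → Ω →ᵇ ℝ, Antitone φ → (∀ x, Tendsto (fun n => φ n x) atTop (𝓝 0)) →
    (∀ n x, |g n x| ≤ φ n x) → Tendsto (fun n => Φ (g n)) atTop (𝓝 0)

theorem IsSigmaSmooth.sub {Φ Ψ : (Ω →ᵇ ℝ) →ₗ[ℝ] ℝ} (hΦ : IsSigmaSmooth Φ)
    (hΨ : IsSigmaSmooth Ψ) : IsSigmaSmooth (Φ - Ψ) := by
  intro φ g h1 h2 h3
  simpa using (hΦ φ g h1 h2 h3).sub (hΨ φ g h1 h2 h3)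

theorem IsSigmaSmooth.exists_le {Φ : (Ω →ᵇ ℝ) →ₗ[ℝ] ℝ} (hΦ : IsSigmaSmooth Φ)
    {φ : ℕ → Ω →ᵇ ℝ} (hφ : Antitone φ) (hφ0 : ∀ x, Tendsto (fun n => φ n x) atTop (𝓝 0))
    {ε : ℝ} (hε : 0 < ε) (N : ℕ) :
    ∃ m, N ≤ m ∧ ∀ g : Ω →ᵇ ℝ, (∀ x, |g x| ≤ φ m x) → |Φ g| ≤ ε := by
  by_contra! H
  have H' : ∀ m, ∃ g : Ω →ᵇ ℝ, (∀ x, |g x| ≤ φ (N + m) x) ∧ ε < |Φ g| :=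
    fun m => H (N + m) (Nat.le_add_right _ _)
  choose g hg hgε using H'
  have h := hΦ (fun m => φ (N + m)) g (fun a b hab => hφ (Nat.add_le_add_left hab N))
    (fun x => by simpa only [add_comm] using (tendsto_add_atTop_iff_nat N).2 (hφ0 x)) hg
  have h' := h.abs
  rw [abs_zero] at h'
  obtain ⟨m, hm⟩ := (h'.eventually (gt_mem_nhds hε)).exists
  exact lt_asymm hm (hgε m)

/-- A sequence of bounded continuous functions whose increments are controlled by a sequence
decreasing to zero pointwise converges to a bounded continuous function. -/
theorem exists_limit_of_increments_le {φ S : ℕ → Ω →ᵇ ℝ} (hφ : Antitone φ)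
    (hφ0 : ∀ x, Tendsto (fun n => φ n x) atTop (𝓝 0))
    (hS : ∀ n x, |S (n + 1) x - S n x| ≤ φ n x - φ (n + 1) x) :
    ∃ h : Ω →ᵇ ℝ, ∀ n x, |h x - S n x| ≤ φ n x := by
  have hnn : ∀ n x, 0 ≤ φ n x := fun n x =>
    le_of_tendsto (hφ0 x) (eventually_atTop.2 ⟨n, fun m hm => hφ hm x⟩)
  have hd : ∀ n k x, |S (n + k) x - S n x| ≤ φ n x - φ (n + k) x := by
    intro n k x
    induction k with
    | zero => simp
    | succ k ih =>
      have h1 := hS (n + k) x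
      rw [show n + (k + 1) = n + k + 1 by ring]
      have h2 := abs_add_le (S (n + k + 1) x - S (n + k) x) (S (n + k) x - S n x)
      rw [sub_add_sub_cancel] at h2
      linarith
  have hd' : ∀ n m x, n ≤ m → |S m x - S n x| ≤ φ n x := by
    intro n m x hnm
    obtain ⟨k, rfl⟩ := Nat.exists_eq_add_of_le hnm
    linarith [hd n k x, hnn (n + k) x]
  have hlim : ∀ x, ∃ y, Tendsto (fun n => S n x) atTop (𝓝 y) := fun x =>
    cauchySeq_tendsto_of_complete (cauchySeq_of_le_tendsto_0' (fun n => φ n x)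
      (fun n m hnm => by rw [dist_comm, Real.dist_eq]; exact hd' n m x hnm) (hφ0 x))
  choose h hh using hlim
  have hb : ∀ n x, |h x - S n x| ≤ φ n x := fun n x =>
    le_of_tendsto ((hh x).sub_const (S n x)).abs
      (eventually_atTop.2 ⟨n, fun m hm => hd' n m x hm⟩)
  -- Dini: the monotone convergence of `φ` is locally uniform; `S` inherits this, so its limit is
  -- continuous.
  have hloc : TendstoLocallyUniformly (fun n x => φ n x) (fun _ => (0 : ℝ)) atTop :=
    Antitone.tendstoLocallyUniformly_of_forall_tendsto (fun n => (φ n).continuous)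
      (fun a b hab => hφ hab) continuous_const hφ0
  have hloc' : TendstoLocallyUniformly (fun n x => S n x) h atTop := by
    rw [Metric.tendstoLocallyUniformly_iff] at hloc ⊢
    intro ε hε x
    obtain ⟨t, ht, hn⟩ := hloc ε hε x
    refine ⟨t, ht, hn.mono fun n hn y hy => ?_⟩
    have h1 := hn y hy
    rw [dist_zero_left, Real.norm_eq_abs, abs_of_nonneg (hnn n y)] at h1
    rw [Real.dist_eq]
    exact (hb n y).trans_lt h1
  have hc : Continuous h :=
    hloc'.continuous (Frequently.of_forall fun n => (S n).continuous)
  refine ⟨BoundedContinuousFunction.ofNormedAddCommGroup h hc (‖φ 0‖ + ‖S 0‖) fun x => ?_,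
    hb⟩
  have h1 := hb 0 x
  have h2 := (S 0).norm_coe_le_norm x
  have h3 := (φ 0).norm_coe_le_norm x
  rw [Real.norm_eq_abs] at *
  have h4 := abs_add_le (h x - S 0 x) (S 0 x)
  rw [sub_add_cancel] at h4
  linarith [le_abs_self (φ 0 x)]

/-- Gliding hump: a sequence of `σ`-smooth functionals converging to zero pointwise converges
to zero along sequences dominated by a sequence decreasing to zero. -/
theorem tendsto_zero_of_dominated {Ψ : ℕ → (Ω →ᵇ ℝ) →ₗ[ℝ] ℝ} (hΨ : ∀ n, IsSigmaSmooth (Ψ n))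
    (hΨ0 : ∀ f, Tendsto (fun n => Ψ n f) atTop (𝓝 0)) {φ g : ℕ → Ω →ᵇ ℝ} (hφ : Antitone φ)
    (hφ0 : ∀ x, Tendsto (fun n => φ n x) atTop (𝓝 0)) (hg : ∀ n x, |g n x| ≤ φ n x) :
    Tendsto (fun n => Ψ n (g n)) atTop (𝓝 0) := by
  by_contra hcon
  have hnn : ∀ n x, 0 ≤ φ n x := fun n x => (abs_nonneg _).trans (hg n x)
  obtain ⟨ε, hε, hfreq⟩ : ∃ ε > 0, ∃ᶠ n in atTop, ε ≤ |Ψ n (g n)| := by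
    rw [Metric.tendsto_nhds] at hcon
    push Not at hcon
    simpa [Real.dist_eq] using hcon
  -- A state is a partial sum of humps together with the index of the `φ` bounding all later
  -- corrections. Each step secures an `n` at which no such correction can bring `|Ψ n h|` below `ε
  -- / 2`.
  have step : ∀ s : (Ω →ᵇ ℝ) × ℕ, ∃ s' : (Ω →ᵇ ℝ) × ℕ, s.2 < s'.2 ∧
      (∀ x, |s'.1 x - s.1 x| ≤ φ s.2 x - φ s'.2 x) ∧
      ∃ n, s.2 ≤ n ∧ ∀ h : Ω →ᵇ ℝ, (∀ x, |h x - s'.1 x| ≤ φ s'.2 x) → ε / 2 ≤ |Ψ n h| := by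
    rintro ⟨S, m⟩
    have h1 : ∀ᶠ n in atTop, |Ψ n S| < ε / 8 := by
      have := (hΨ0 S).abs
      rw [abs_zero] at this
      exact this.eventually (gt_mem_nhds (by positivity))
    obtain ⟨n, hn1, hn2, hn3⟩ := (hfreq.and_eventually (h1.and (eventually_ge_atTop m))).exists
    -- The new hump is `g n` with its part inside `[-φ m', φ m']` removed. The old sum, the removed
    -- part and later corrections cost at most `ε / 8` each, leaving more than `ε / 2` of `|Ψ n (g
    -- n)| ≥ ε`.
    obtain ⟨m', hm', hm'2⟩ := (hΨ n).exists_le hφ hφ0 (show 0 < ε / 8 by positivity) (n + 1)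
    refine ⟨(S + (g n - clip (g n) (φ m')), m'), by simp only; omega, fun x => ?_, n, hn3,
      fun h hh => ?_⟩
    · have e : (S + (g n - clip (g n) (φ m'))) x - S x = g n x - clip (g n) (φ m') x := by
        simp
      simp only [e]
      rw [abs_sub_clip _ (hnn _ _)]
      have h2 : φ m' x ≤ φ m x := hφ (by omega) x
      have h3 : φ n x ≤ φ m x := hφ hn3 x
      exact max_le (by linarith [hg n x]) (by linarith)
    · have h2 := hm'2 (h - (S + (g n - clip (g n) (φ m')))) hh
      have h3 := hm'2 (clip (g n) (φ m')) fun x => abs_clip_le _ (hnn _ _)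
      have e : Ψ n h = Ψ n (h - (S + (g n - clip (g n) (φ m')))) + Ψ n S + Ψ n (g n)
          - Ψ n (clip (g n) (φ m')) := by
        simp only [map_sub, map_add]; ring
      rw [abs_le] at h2 h3
      rw [abs_lt] at hn2
      rcases le_abs'.1 hn1 with h4 | h4
      · exact le_abs'.2 (Or.inl (by linarith))
      · exact le_abs'.2 (Or.inr (by linarith))
  choose F hF1 hF2 hF3 using step
  let s : ℕ → (Ω →ᵇ ℝ) × ℕ := fun k => Nat.rec (0, 0) (fun _ p => F p) k
  have hs : ∀ k, s (k + 1) = F (s k) := fun k => rfl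
  have hmono : StrictMono fun k => (s k).2 := strictMono_nat_of_lt_succ fun k => by
    rw [hs]; exact hF1 _
  obtain ⟨h, hh⟩ := exists_limit_of_increments_le (φ := fun k => φ (s k).2)
    (S := fun k => (s k).1) (fun a b hab => hφ (hmono.monotone hab))
    (fun x => (hφ0 x).comp hmono.tendsto_atTop) (fun k x => by rw [hs]; exact hF2 _ x)
  have hlim := (hΨ0 h).abs
  rw [abs_zero] at hlim
  obtain ⟨N, hN⟩ := eventually_atTop.1 (hlim.eventually (gt_mem_nhds (half_pos hε)))
  obtain ⟨n, hn, hn'⟩ := hF3 (s N)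
  exact absurd (hN n ((hmono.id_le N).trans hn)) (not_lt.2 (hn' h (hh (N + 1))))

/-- On a family of `σ`-smooth functionals in which each sequence has a subsequence converging
pointwise to a member, smoothness is uniform. -/
theorem exists_forall_le_of_seqCompact {ι : Type*} {Φ : ι → (Ω →ᵇ ℝ) →ₗ[ℝ] ℝ}
    (hΦ : ∀ p, IsSigmaSmooth (Φ p))
    (hseq : ∀ u : ℕ → ι, ∃ q, ∃ σ : ℕ → ℕ, StrictMono σ ∧
      ∀ f, Tendsto (fun n => Φ (u (σ n)) f) atTop (𝓝 (Φ q f)))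
    {φ : ℕ → Ω →ᵇ ℝ} (hφ : Antitone φ) (hφ0 : ∀ x, Tendsto (fun n => φ n x) atTop (𝓝 0))
    {ε : ℝ} (hε : 0 < ε) :
    ∃ n, ∀ p, ∀ g : Ω →ᵇ ℝ, (∀ x, |g x| ≤ φ n x) → |Φ p g| ≤ ε := by
  by_contra! H
  choose u g hg hgε using H
  obtain ⟨q, σ, hσ, hq⟩ := hseq u
  have hφσ : Antitone fun n => φ (σ n) := fun a b hab => hφ (hσ.monotone hab)
  have hφσ0 : ∀ x, Tendsto (fun n => φ (σ n) x) atTop (𝓝 0) :=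
    fun x => (hφ0 x).comp hσ.tendsto_atTop
  -- Subtracting the limit functional gives a pointwise null sequence; the limit is handled by its
  -- own smoothness.
  have h1 := tendsto_zero_of_dominated (Ψ := fun n => Φ (u (σ n)) - Φ q)
    (fun n => (hΦ _).sub (hΦ q))
    (fun f => by simpa using (hq f).sub_const (Φ q f)) hφσ hφσ0 (fun n => hg (σ n))
  have h2 := (h1.add (hΦ q _ _ hφσ hφσ0 (fun n => hg (σ n)))).abs
  simp only [LinearMap.sub_apply, sub_add_cancel, add_zero, abs_zero] at h2
  obtain ⟨n, hn⟩ := (h2.eventually (gt_mem_nhds hε)).exists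
  exact lt_asymm hn (hgε (σ n))

end SigmaSmooth

/-! ### Uniform tightness and domination by strict seminorms -/

section UniformlyTight

variable {Ω : Type*} [TopologicalSpace Ω]

/-- A family of functionals is uniformly tight if it is uniformly small on the functions of the
unit ball which vanish on a suitable compact set. -/
def IsUniformlyTight {ι : Type*} (Φ : ι → (Ω →ᵇ ℝ) →ₗ[ℝ] ℝ) : Prop :=
  ∀ ε > 0, ∃ L : Compacts Ω, ∀ p, ∀ f : Ω →ᵇ ℝ, (∀ x, |f x| ≤ 1) → (∀ x ∈ L, f x = 0) →
    |Φ p f| ≤ ε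

/-- Riesz decomposition: clipping `g` at the last `ψ` leaves a remainder dominated by the sum of the
others. -/
theorem abs_map_le_sum {Φ : (Ω →ᵇ ℝ) →ₗ[ℝ] ℝ} {ψ : ℕ → Ω →ᵇ ℝ} {e : ℕ → ℝ}
    (hψ : ∀ k x, 0 ≤ ψ k x) (h : ∀ k, ∀ g : Ω →ᵇ ℝ, (∀ x, |g x| ≤ ψ k x) → |Φ g| ≤ e k)
    (N : ℕ) (g : Ω →ᵇ ℝ) (hg : ∀ x, |g x| ≤ ∑ k ∈ Finset.range N, ψ k x) :
    |Φ g| ≤ ∑ k ∈ Finset.range N, e k := by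
  induction N generalizing g with
  | zero =>
    have : g = 0 := by
      ext x
      simpa using hg x
    simp [this]
  | succ N ih =>
    have h1 := h N (clip g (ψ N)) fun x => abs_clip_le _ (hψ N x)
    have h2 := ih (g - clip g (ψ N)) fun x => by
      rw [BoundedContinuousFunction.coe_sub, Pi.sub_apply, abs_sub_clip _ (hψ N x)]
      have := hg x
      rw [Finset.sum_range_succ] at this
      exact max_le (by linarith) (Finset.sum_nonneg fun k _ => hψ k x)
    have h3 := abs_add_le (Φ (g - clip g (ψ N))) (Φ (clip g (ψ N)))
    rw [← map_add, sub_add_cancel] at h3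
    rw [Finset.sum_range_succ]
    linarith

/-- A separable metric space carries continuous functions decreasing to zero, each of which is
small only near a finite set. -/
theorem exists_antitone_finite_nets (Ω : Type*) [MetricSpace Ω] [SeparableSpace Ω] [Nonempty Ω] :
    ∃ φ : ℕ → Ω →ᵇ ℝ, Antitone φ ∧ (∀ x, Tendsto (fun n => φ n x) atTop (𝓝 0)) ∧
      (∀ n x, 0 ≤ φ n x) ∧
      ∀ n, ∃ D : Set Ω, D.Finite ∧ ∀ x, ∀ r ≤ 1, φ n x < r → ∃ y ∈ D, dist x y < r := by
  let D : ℕ → Set Ω := fun n => denseSeq Ω '' Set.Iic n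
  have hDne : ∀ n, (D n).Nonempty := fun n => ⟨_, ⟨n, Set.mem_Iic.2 le_rfl, rfl⟩⟩
  have hnn : ∀ n x, 0 ≤ min 1 (Metric.infDist x (D n)) := fun n x =>
    le_min zero_le_one Metric.infDist_nonneg
  let φ : ℕ → Ω →ᵇ ℝ := fun n => BoundedContinuousFunction.ofNormedAddCommGroup
    (fun x => min 1 (Metric.infDist x (D n)))
    (continuous_const.min (Metric.continuous_infDist_pt _)) 1
    fun x => by
      rw [Real.norm_eq_abs, abs_of_nonneg (hnn n x)]
      exact min_le_left _ _
  have hφ : ∀ n x, φ n x = min 1 (Metric.infDist x (D n)) := fun n x => rfl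
  refine ⟨φ, fun a b hab x => ?_, fun x => ?_, hnn, fun n => ⟨D n, (Set.finite_Iic n).image _,
    fun x r hr h => ?_⟩⟩
  · exact min_le_min le_rfl (Metric.infDist_le_infDist_of_subset
      (Set.image_mono (Set.Iic_subset_Iic.2 hab)) (hDne a))
  · rw [Metric.tendsto_atTop]
    intro ε hε
    obtain ⟨i, hi⟩ := (denseRange_denseSeq Ω).exists_dist_lt x hε
    refine ⟨i, fun n hn => ?_⟩
    rw [Real.dist_eq, sub_zero, hφ, abs_of_nonneg (hnn n x)]
    exact (min_le_right _ _).trans_lt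
      ((Metric.infDist_le_dist_of_mem (Set.mem_image_of_mem _ (Set.mem_Iic.2 hn))).trans_lt hi)
  · rw [hφ, min_lt_iff] at h
    exact (Metric.infDist_lt_iff (hDne n)).1 (h.resolve_left (not_lt.2 hr))

/-- Uniform smoothness makes functions dominated by `(k + 1) • φ (n k)` cost at most `ε / 2 / 2 ^
k`. The set where all these multiples are at most `1` is closed and totally bounded, hence compact
for a complete metric. Off it some multiple exceeds `1`, so an `f` in the unit ball vanishing on it
is pointwise eventually dominated by the partial sums. -/
theorem isUniformlyTight_of_seqCompact [PolishSpace Ω] {ι : Type*} {Φ : ι → (Ω →ᵇ ℝ) →ₗ[ℝ] ℝ}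
    (hΦ : ∀ p, IsSigmaSmooth (Φ p))
    (hseq : ∀ u : ℕ → ι, ∃ q, ∃ σ : ℕ → ℕ, StrictMono σ ∧
      ∀ f, Tendsto (fun n => Φ (u (σ n)) f) atTop (𝓝 (Φ q f))) :
    IsUniformlyTight Φ := by
  intro ε hε
  rcases isEmpty_or_nonempty Ω with hE | hne
  · refine ⟨⊥, fun p f _ _ => ?_⟩
    rw [show f = 0 from BoundedContinuousFunction.ext fun x => hE.elim x]
    simpa using hε.le
  let := upgradeIsCompletelyMetrizable Ω
  obtain ⟨φ, hφ, hφ0, hnn, hD⟩ := exists_antitone_finite_nets Ω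
  have hk : ∀ k : ℕ, ∃ n, ∀ p, ∀ g : Ω →ᵇ ℝ, (∀ x, |g x| ≤ (((k : ℝ) + 1) • φ n) x) →
      |Φ p g| ≤ ε / 2 / 2 ^ k := fun k => by
    refine exists_forall_le_of_seqCompact hΦ hseq (φ := fun n => ((k : ℝ) + 1) • φ n)
      (fun a b hab x => ?_) (fun x => ?_) (by positivity)
    · exact mul_le_mul_of_nonneg_left (hφ hab x) (by positivity)
    · simpa using (hφ0 x).const_mul ((k : ℝ) + 1)
  choose n hn using hk
  let ψ : ℕ → Ω →ᵇ ℝ := fun k => ((k : ℝ) + 1) • φ (n k)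
  have hψ : ∀ k x, ψ k x = (k + 1) * φ (n k) x := fun k x => rfl
  have hψ0 : ∀ k x, 0 ≤ ψ k x := fun k x => by
    rw [hψ]; exact mul_nonneg (by positivity) (hnn _ _)
  let L : Set Ω := {x | ∀ k, ψ k x ≤ 1}
  have hL : IsCompact L := by
    refine TotallyBounded.isCompact_of_isClosed ?_ ?_
    · rw [Metric.totallyBounded_iff]
      intro r hr
      obtain ⟨k, hk⟩ := exists_nat_one_div_lt (lt_min hr one_pos)
      obtain ⟨D, hDf, hD⟩ := hD (n k)
      refine ⟨D, hDf, fun x hx => ?_⟩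
      have hk0 : (0 : ℝ) < k + 1 := by positivity
      have h1 : φ (n k) x ≤ 1 / (k + 1) := by
        rw [le_div_iff₀ hk0, mul_comm]
        exact hx k
      obtain ⟨y, hy, hxy⟩ := hD x _ (min_le_right r 1) (h1.trans_lt hk)
      exact Set.mem_biUnion hy (hxy.trans_le (min_le_left r 1))
    · simp only [L, Set.ofPred_forall]
      exact isClosed_iInter fun k => isClosed_le (ψ k).continuous continuous_const
  refine ⟨⟨L, hL⟩, fun p f hf1 hf0 => ?_⟩
  let s : ℕ → Ω →ᵇ ℝ := fun N => ∑ k ∈ Finset.range N, ψ k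
  have hs : ∀ N x, s N x = ∑ k ∈ Finset.range N, ψ k x := fun N x => by
    simp [s, BoundedContinuousFunction.coe_sum]
  have hs0 : ∀ N x, 0 ≤ s N x := fun N x => by
    rw [hs]; exact Finset.sum_nonneg fun k _ => hψ0 k x
  have hsmono : ∀ x, Monotone fun N => s N x := fun x => monotone_nat_of_le_succ fun N => by
    rw [hs, hs, Finset.sum_range_succ]
    linarith [hψ0 N x]
  have habs : ∀ N x, |f - clip f (s N)| x = max (|f x| - s N x) 0 := fun N x =>
    abs_sub_clip f (hs0 N x)
  -- The remainders decrease pointwise to zero, so smoothness of the single functional `Φ p` reduces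
  -- the bound to clips at finite sums.
  have hlim : Tendsto (fun N => Φ p (f - clip f (s N))) atTop (𝓝 0) := by
    refine hΦ p (fun N => |f - clip f (s N)|) _ (fun a b hab x => ?_) (fun x => ?_)
      fun N x => le_rfl
    · change |f - clip f (s b)| x ≤ |f - clip f (s a)| x
      rw [habs, habs]
      exact max_le_max (by linarith [hsmono x hab]) le_rfl
    · have : ∃ N, |f x| ≤ s N x := by
        by_cases hx : x ∈ L
        · exact ⟨0, by rw [hf0 x hx, abs_zero]; exact hs0 _ _⟩
        · simp only [L, Set.mem_ofPred_eq, not_forall, not_le] at hx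
          obtain ⟨k, hk⟩ := hx
          refine ⟨k + 1, (hf1 x).trans (hk.le.trans ?_)⟩
          rw [hs, Finset.sum_range_succ]
          linarith [Finset.sum_nonneg fun i (_ : i ∈ Finset.range k) => hψ0 i x]
      obtain ⟨N, hN⟩ := this
      refine tendsto_const_nhds.congr' (eventually_atTop.2 ⟨N, fun m hm => ?_⟩)
      refine Eq.symm ((habs m x).trans (max_eq_right ?_))
      linarith [hsmono x hm]
  have hlim' : Tendsto (fun N => |Φ p (clip f (s N))|) atTop (𝓝 |Φ p f|) := by
    have := (hlim.const_sub (Φ p f)).abs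
    simpa only [map_sub, sub_sub_cancel, sub_zero] using this
  refine le_of_tendsto hlim' (Eventually.of_forall fun N => ?_)
  refine (abs_map_le_sum hψ0 (fun k => hn k p) N _ fun x => ?_).trans ?_
  · rw [← hs]
    exact abs_clip_le f (hs0 N x)
  · have hsum := hasSum_geometric_two' ε
    exact sum_le_hasSum _ (fun k _ => by positivity) hsum

/-- For large `n` the weight alone makes the norm bound small; the remaining finitely many families
share a finite union of compact sets. -/
theorem IsUniformlyTight.sigma_smul {ι : ℕ → Type*} {Φ : ∀ n, ι n → (Ω →ᵇ ℝ) →ₗ[ℝ] ℝ}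
    (hΦ : ∀ n, IsUniformlyTight (Φ n)) {M : ℝ} (hM : ∀ n p f, |Φ n p f| ≤ M * ‖f‖)
    {a : ℕ → ℝ} (ha : ∀ n, 0 ≤ a n) (ha0 : Tendsto a atTop (𝓝 0)) :
    IsUniformlyTight fun p : Σ n, ι n => a p.1 • Φ p.1 p.2 := by
  intro ε hε
  have h1 : ∀ᶠ n in atTop, a n * |M| < ε := by
    have := ha0.mul_const |M|
    rw [zero_mul] at this
    exact this.eventually (gt_mem_nhds hε)
  obtain ⟨N, hN⟩ := eventually_atTop.1 h1
  have h2 : ∀ n, 0 < ε / (a n + 1) := fun n => div_pos hε (by linarith [ha n])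
  choose L hL using fun n => hΦ n _ (h2 n)
  refine ⟨(Finset.range N).sup L, ?_⟩
  rintro ⟨n, p⟩ f hf1 hf0
  simp only [LinearMap.smul_apply, smul_eq_mul, abs_mul, abs_of_nonneg (ha n)]
  rcases lt_or_ge n N with hn | hn
  · have h3 := hL n p f hf1 fun x hx =>
      hf0 x ((Finset.le_sup (f := L) (Finset.mem_range.2 hn) : L n ≤ _) hx)
    refine (mul_le_mul_of_nonneg_left h3 (ha n)).trans ?_
    rw [mul_div_assoc', div_le_iff₀ (by linarith [ha n])]
    nlinarith
  · refine le_trans ?_ (hN n hn).le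
    refine mul_le_mul_of_nonneg_left ((hM n p f).trans ?_) (ha n)
    have h3 : ‖f‖ ≤ 1 := (f.norm_le zero_le_one).2 hf1
    calc M * ‖f‖ ≤ |M| * ‖f‖ := mul_le_mul_of_nonneg_right (le_abs_self M) (norm_nonneg f)
      _ ≤ |M| * 1 := mul_le_mul_of_nonneg_left h3 (abs_nonneg M)
      _ = |M| := mul_one _

theorem abs_clip_sub_clip_le (f : Ω →ᵇ ℝ) {c d : ℝ} (hcd : c ≤ d) (x : Ω) :
    |clip f (BoundedContinuousFunction.const Ω d) x -
      clip f (BoundedContinuousFunction.const Ω c) x| ≤ d - c := by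
  simp only [clip_apply, BoundedContinuousFunction.const_apply]
  rw [abs_le]
  rcases le_total (f x) c with h1 | h1 <;> rcases le_total (f x) d with h2 | h2 <;>
    simp only [h1, h2, min_eq_left, min_eq_right] <;>
    constructor <;> rw [max_def, max_def] <;> split_ifs <;> linarith

theorem mul_supSeminorm_le_strictSeminorm (q : StrictIndex Ω) (n : ℕ) (f : Ω →ᵇ ℝ) :
    q.1.2 n * supSeminorm (q.1.1 n) f ≤ strictSeminorm q f := by
  obtain ⟨C, hC⟩ := q.2.2.bddAbove_range
  refine le_ciSup (f := fun n => q.1.2 n * supSeminorm (q.1.1 n) f) ⟨C * ‖f‖, ?_⟩ n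
  rintro _ ⟨m, rfl⟩
  have h1 : q.1.2 m ≤ C := hC ⟨m, rfl⟩
  exact mul_le_mul h1 (supSeminorm_le_norm _ f) (apply_nonneg _ _) ((q.2.1 m).trans h1)

theorem strictSeminorm_le {q : StrictIndex Ω} {f : Ω →ᵇ ℝ} {c : ℝ}
    (h : ∀ n, q.1.2 n * supSeminorm (q.1.1 n) f ≤ c) : strictSeminorm q f ≤ c :=
  ciSup_le h

theorem abs_le_supSeminorm {K : Compacts Ω} {x : Ω} (hx : x ∈ K) (f : Ω →ᵇ ℝ) :
    |f x| ≤ supSeminorm K f :=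
  le_ciSup (f := fun y : K => |f y|)
    ⟨‖f‖, by rintro _ ⟨y, rfl⟩; exact f.norm_coe_le_norm y⟩ ⟨x, hx⟩

theorem supSeminorm_le {K : Compacts Ω} {f : Ω →ᵇ ℝ} {c : ℝ} (hc : 0 ≤ c)
    (h : ∀ x ∈ K, |f x| ≤ c) : supSeminorm K f ≤ c :=
  Real.iSup_le (fun x => h x x.2) hc

/-- A bounded uniformly tight family of functionals is dominated by a seminorm of the strict
topology. -/
theorem IsUniformlyTight.exists_le_strictSeminorm {ι : Type*} {Φ : ι → (Ω →ᵇ ℝ) →ₗ[ℝ] ℝ}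
    (hΦ : IsUniformlyTight Φ) {M : ℝ} (hM : ∀ p f, |Φ p f| ≤ M * ‖f‖) :
    ∃ q : StrictIndex Ω, ∃ C : ℝ, 0 < C ∧ ∀ p f, |Φ p f| ≤ C * strictSeminorm q f := by
  -- In the unit ball of `q` one has `|f| ≤ 2 ^ j` on `L j`, so the slice of `f` between levels `2 ^
  -- j` and `2 ^ (j + 1)` vanishes there. Its size is at most `2 ^ j`, so tolerance `4⁻ʲ` bounds its
  -- image by `2⁻ʲ`. These bounds sum to `2`, and the bottom clip contributes `|M|`.
  choose L hL using fun j : ℕ => hΦ ((1 / 4 : ℝ) ^ j) (by positivity)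
  let q : StrictIndex Ω := ⟨(L, fun j => (1 / 2 : ℝ) ^ j), fun j => by positivity,
    tendsto_pow_atTop_nhds_zero_of_lt_one (by norm_num) (by norm_num)⟩
  have key : ∀ p f, strictSeminorm q f ≤ 1 → |Φ p f| ≤ |M| + 2 := by
    intro p f hf
    have hfL : ∀ j, ∀ x ∈ L j, |f x| ≤ 2 ^ j := fun j x hx => by
      have h1 : (1 / 2 : ℝ) ^ j * supSeminorm (L j) f ≤ 1 :=
        (mul_supSeminorm_le_strictSeminorm q j f).trans hf
      have h2 := abs_le_supSeminorm hx f
      rw [one_div, inv_pow, inv_mul_le_iff₀ (by positivity), mul_one] at h1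
      exact h2.trans h1
    let g : ℕ → Ω →ᵇ ℝ := fun j => clip f (BoundedContinuousFunction.const Ω (2 ^ j))
    have hc : ∀ j x, |f x| ≤ 2 ^ j → g j x = f x := fun j x hx => clip_eq_self hx
    have hstep : ∀ j, |Φ p (g (j + 1) - g j)| ≤ 1 / 2 ^ j := fun j => by
      have h1 := hL j p (((2 : ℝ) ^ j)⁻¹ • (g (j + 1) - g j)) (fun x => by
          have := abs_clip_sub_clip_le f (c := 2 ^ j) (d := 2 ^ (j + 1))
            (pow_le_pow_right₀ one_le_two j.le_succ) x
          simp only [BoundedContinuousFunction.coe_smul, BoundedContinuousFunction.coe_sub,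
            Pi.sub_apply, smul_eq_mul, abs_mul, abs_inv, abs_pow, Nat.abs_ofNat]
          rw [inv_mul_le_iff₀ (by positivity)]
          refine this.trans (le_of_eq ?_)
          ring) fun x hx => by
          have h2 := hfL j x hx
          have h3 : |f x| ≤ 2 ^ (j + 1) := h2.trans (pow_le_pow_right₀ one_le_two j.le_succ)
          simp [hc j x h2, hc (j + 1) x h3]
      rw [map_smul, smul_eq_mul, abs_mul, abs_inv, abs_pow, Nat.abs_ofNat,
        inv_mul_le_iff₀ (by positivity), ← mul_pow] at h1
      refine h1.trans (le_of_eq ?_)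
      rw [← one_div_pow]
      norm_num
    have hsum : ∀ j, |Φ p (g j)| ≤ |M| + 2 - 2 / 2 ^ j := fun j => by
      induction j with
      | zero =>
        have h1 : ‖g 0‖ ≤ 1 := ((g 0).norm_le zero_le_one).2 fun x => by
          have := abs_clip_le f (φ := BoundedContinuousFunction.const Ω ((2 : ℝ) ^ 0)) (x := x)
            (by simp)
          simpa [g] using this
        calc |Φ p (g 0)| ≤ M * ‖g 0‖ := hM p _
          _ ≤ |M| * ‖g 0‖ := mul_le_mul_of_nonneg_right (le_abs_self M) (norm_nonneg _)
          _ ≤ |M| * 1 := mul_le_mul_of_nonneg_left h1 (abs_nonneg M)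
          _ = _ := by simp
      | succ j ih =>
        have h1 := abs_add_le (Φ p (g (j + 1) - g j)) (Φ p (g j))
        rw [← map_add, sub_add_cancel] at h1
        have h2 : (2 : ℝ) / 2 ^ (j + 1) = 1 / 2 ^ j := by rw [pow_succ]; field_simp
        have h3 : (2 : ℝ) / 2 ^ j = 2 * (1 / 2 ^ j) := by ring
        linarith [hstep j]
    obtain ⟨j, hj⟩ := pow_unbounded_of_one_lt ‖f‖ (one_lt_two (α := ℝ))
    have hgf : g j = f := BoundedContinuousFunction.ext fun x =>
      hc j x ((f.norm_coe_le_norm x).trans hj.le)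
    have h1 := hsum j
    rw [hgf] at h1
    have h2 : (0 : ℝ) ≤ 2 / 2 ^ j := by positivity
    linarith
  refine ⟨q, |M| + 2, by positivity, fun p f => ?_⟩
  have hC : 0 < |M| + 2 := by positivity
  refine le_of_forall_pos_le_add fun δ hδ => ?_
  -- The added term keeps the normalising factor positive even where the seminorm vanishes.
  set s := strictSeminorm q f + δ / (|M| + 2) with hs
  have hs0 : 0 < s := add_pos_of_nonneg_of_pos (apply_nonneg _ _) (by positivity)
  have h1 := key p (s⁻¹ • f) (by
    rw [map_smul_eq_mul, norm_inv, Real.norm_eq_abs, abs_of_pos hs0, inv_mul_le_iff₀ hs0, mul_one]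
    have : 0 < δ / (|M| + 2) := by positivity
    linarith)
  rw [map_smul, smul_eq_mul, abs_mul, abs_inv, abs_of_pos hs0, inv_mul_le_iff₀ hs0] at h1
  refine h1.trans (le_of_eq ?_)
  rw [hs]
  field_simp

end UniformlyTight

/-! ### Comparing compact-open, strict and norm convergence -/

section Convergence

variable {Ω : Type*} [TopologicalSpace Ω] {ι : Type*} {l : Filter ι} {u : ι → Ω →ᵇ ℝ}
  {f : Ω →ᵇ ℝ}

theorem tendsto_strictTopology_iff :
    Tendsto u l (@nhds _ (strictTopology Ω) f) ↔
      ∀ q : StrictIndex Ω, ∀ ε, 0 < ε → ∀ᶠ i in l, strictSeminorm q (u i - f) < ε := by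
  have h : @WithSeminorms ℝ (Ω →ᵇ ℝ) (StrictIndex Ω) _ _ _ strictSeminorm (strictTopology Ω) :=
    @WithSeminorms.mk _ _ _ _ _ _ _ (strictTopology Ω) rfl
  exact @WithSeminorms.tendsto_nhds _ _ _ _ _ _ _ (strictTopology Ω) strictSeminorm h u l f

theorem tendsto_tauC_iff :
    Tendsto u l (@nhds _ (tauC Ω) f) ↔
      ∀ K : Compacts Ω, ∀ ε, 0 < ε → ∀ᶠ i in l, supSeminorm K (u i - f) < ε := by
  rw [tauC, nhds_induced, tendsto_comap_iff,
    ContinuousMap.tendsto_iff_forall_isCompact_tendstoUniformlyOn]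
  simp only [Metric.tendstoUniformlyOn_iff]
  refine ⟨fun h K ε hε => ?_, fun h K hK ε hε => ?_⟩
  · refine (h K K.isCompact (ε / 2) (half_pos hε)).mono fun i hi => ?_
    refine (supSeminorm_le (half_pos hε).le fun x hx => ?_).trans_lt (half_lt_self hε)
    have := hi x hx
    rw [dist_comm, Real.dist_eq] at this
    exact this.le
  · refine (h ⟨K, hK⟩ ε hε).mono fun i hi x hx => ?_
    rw [dist_comm, Real.dist_eq]
    exact (abs_le_supSeminorm (K := ⟨K, hK⟩) hx (u i - f)).trans_lt hi

theorem tendsto_tauC_of_tendsto_strictTopology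
    (h : Tendsto u l (@nhds _ (strictTopology Ω) f)) : Tendsto u l (@nhds _ (tauC Ω) f) := by
  rw [tendsto_strictTopology_iff] at h
  rw [tendsto_tauC_iff]
  intro K ε hε
  let q : StrictIndex Ω := ⟨(fun _ => K, fun n => 1 / ((n : ℝ) + 1)), fun n => by positivity,
    tendsto_one_div_add_atTop_nhds_zero_nat⟩
  refine (h q ε hε).mono fun i hi => lt_of_le_of_lt ?_ hi
  have := mul_supSeminorm_le_strictSeminorm q 0 (u i - f)
  simpa [q] using this

/-- On norm-bounded sets, convergence in the compact-open topology implies convergence in the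
strict topology. -/
theorem tendsto_strictTopology_of_tendsto_tauC {C : ℝ} (hC : ∀ᶠ i in l, ‖u i‖ ≤ C)
    (h : Tendsto u l (@nhds _ (tauC Ω) f)) : Tendsto u l (@nhds _ (strictTopology Ω) f) := by
  rw [tendsto_tauC_iff] at h
  rw [tendsto_strictTopology_iff]
  intro q ε hε
  -- Small weights control the tail through the norm bound; only finitely many compact sets remain.
  have h1 : ∀ᶠ n in atTop, q.1.2 n * (C + ‖f‖) < ε / 2 := by
    have := q.2.2.mul_const (C + ‖f‖)
    rw [zero_mul] at this
    exact this.eventually (gt_mem_nhds (half_pos hε))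
  obtain ⟨N, hN⟩ := eventually_atTop.1 h1
  have ha : ∀ n, 0 < q.1.2 n + 1 := fun n => by linarith [q.2.1 n]
  have h2 : ∀ᶠ i in l, ∀ n ∈ Finset.range N,
      supSeminorm (q.1.1 n) (u i - f) < ε / 2 / (q.1.2 n + 1) :=
    (eventually_all_finset _).2 fun n _ => h _ _ (div_pos (half_pos hε) (ha n))
  filter_upwards [hC, h2] with i hi hi2
  refine (strictSeminorm_le fun n => ?_).trans_lt (half_lt_self hε)
  rcases lt_or_ge n N with hn | hn
  · refine (mul_le_mul_of_nonneg_left (hi2 n (Finset.mem_range.2 hn)).le (q.2.1 n)).trans ?_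
    rw [mul_div_assoc', div_le_iff₀ (ha n)]
    nlinarith
  · refine le_trans (mul_le_mul_of_nonneg_left ((supSeminorm_le_norm _ _).trans ?_) (q.2.1 n))
      (hN n hn).le
    exact (norm_sub_le _ _).trans (by linarith)

theorem isStronglyContinuous_iff {X : Type*} [AddCommGroup X] [Module ℝ X]
    {τ : TopologicalSpace X} {T : ℝ≥0 → X →ₗ[ℝ] X} :
    IsStronglyContinuous τ T ↔
      ∀ x t, Tendsto (fun s => T s x) (𝓝 t) (@nhds X τ (T t x)) := by
  simp only [IsStronglyContinuous, continuous_iff_continuousAt, ContinuousAt]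

/-- Phrased with filters, uniformity in `t` lets the convergence comparisons apply directly to
pairs. -/
theorem isLocallyEquicontinuous_iff {X : Type*} [AddCommGroup X] [Module ℝ X]
    {τ : TopologicalSpace X} {T : ℝ≥0 → X →ₗ[ℝ] X} :
    IsLocallyEquicontinuous τ T ↔ ∀ t₀ : ℝ≥0,
      Tendsto (fun p : X × ℝ≥0 => T p.2 p.1) (@nhds X τ 0 ×ˢ 𝓟 (Set.Iic t₀)) (@nhds X τ 0) := by
  refine forall_congr' fun t₀ => ⟨fun h U hU => ?_, fun h U hU => ?_⟩
  · obtain ⟨V, hV, hVU⟩ := h U hU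
    exact mem_prod_principal.2 (mem_of_superset hV fun x hx t ht => hVU t ht x hx)
  · exact ⟨_, mem_prod_principal.1 (h hU), fun t ht x hx => hx t ht⟩

theorem isLocallyBiEquicontinuous_iff {X : Type*} [NormedAddCommGroup X] [NormedSpace ℝ X]
    {τ : TopologicalSpace X} {T : ℝ≥0 → X →ₗ[ℝ] X} :
    IsLocallyBiEquicontinuous τ T ↔ ∀ u : ℕ → X, Bornology.IsBounded (Set.range u) →
      Tendsto u atTop (@nhds X τ 0) → ∀ t₀ : ℝ≥0,
        Tendsto (fun p : ℕ × ℝ≥0 => T p.2 (u p.1)) (atTop ×ˢ 𝓟 (Set.Iic t₀)) (@nhds X τ 0) := by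
  refine forall₄_congr fun u _ _ t₀ => ⟨fun h U hU => ?_, fun h U hU => ?_⟩
  · exact mem_prod_principal.2 (h U hU)
  · exact mem_prod_principal.1 (h hU)

theorem tendsto_tauC_sub_iff :
    Tendsto (fun i => u i - f) l (@nhds _ (tauC Ω) 0) ↔ Tendsto u l (@nhds _ (tauC Ω) f) := by
  simp only [tendsto_tauC_iff, sub_zero]

theorem tendsto_strictTopology_sub_iff :
    Tendsto (fun i => u i - f) l (@nhds _ (strictTopology Ω) 0) ↔
      Tendsto u l (@nhds _ (strictTopology Ω) f) := by
  simp only [tendsto_strictTopology_iff, sub_zero]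

theorem nhds_zero_le_nhds_strictTopology :
    𝓝 (0 : Ω →ᵇ ℝ) ≤ @nhds _ (strictTopology Ω) 0 := by
  refine tendsto_id'.1 (tendsto_strictTopology_of_tendsto_tauC (C := 1) ?_ ?_)
  · filter_upwards [Metric.closedBall_mem_nhds (0 : Ω →ᵇ ℝ) one_pos] with f hf
    simpa using hf
  · rw [tendsto_tauC_iff]
    intro K ε hε
    filter_upwards [Metric.ball_mem_nhds (0 : Ω →ᵇ ℝ) hε] with f hf
    rw [id, sub_zero]
    exact (supSeminorm_le_norm K f).trans_lt (by simpa using hf)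

end Convergence

/-! ### Consequences of membership in `semigroupClassF` -/

section Semigroup

variable {Ω : Type*} [TopologicalSpace Ω] {T : ℝ≥0 → (Ω →ᵇ ℝ) →ₗ[ℝ] (Ω →ᵇ ℝ)}

/-- The functional `f ↦ (S f) x`. -/
def pointFunctional (S : (Ω →ᵇ ℝ) →ₗ[ℝ] (Ω →ᵇ ℝ)) (x : Ω) : (Ω →ᵇ ℝ) →ₗ[ℝ] ℝ where
  toFun f := S f x
  map_add' f g := by simp
  map_smul' c f := by simp

theorem pointFunctional_apply (S : (Ω →ᵇ ℝ) →ₗ[ℝ] (Ω →ᵇ ℝ)) (x : Ω) (f : Ω →ᵇ ℝ) :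
    pointFunctional S x f = S f x := rfl

theorem IsSeqContinuousOnBounded.isSigmaSmooth {S : (Ω →ᵇ ℝ) →ₗ[ℝ] (Ω →ᵇ ℝ)}
    (hS : IsSeqContinuousOnBounded (tauC Ω) S) (x : Ω) : IsSigmaSmooth (pointFunctional S x) := by
  intro φ g hφ hφ0 hg
  have hb : ∀ n, ‖g n‖ ≤ ‖φ 0‖ := fun n => ((g n).norm_le (norm_nonneg _)).2 fun y =>
    (hg n y).trans ((hφ n.zero_le y).trans ((le_abs_self _).trans ((φ 0).norm_coe_le_norm y)))
  have hlim : Tendsto g atTop (@nhds _ (tauC Ω) 0) := by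
    rw [tendsto_tauC_iff]
    intro K ε hε
    have h1 : TendstoUniformlyOn (fun n y => φ n y) (fun _ => (0 : ℝ)) atTop K :=
      Antitone.tendstoUniformlyOn_of_forall_tendsto K.isCompact
        (fun n => (φ n).continuous.continuousOn) (fun y _ a b hab => hφ hab y)
        continuousOn_const fun y _ => hφ0 y
    refine (Metric.tendstoUniformlyOn_iff.1 h1 (ε / 2) (half_pos hε)).mono fun n hn => ?_
    refine (supSeminorm_le (half_pos hε).le fun y hy => ?_).trans_lt (half_lt_self hε)
    have h2 := hn y hy
    rw [dist_zero_left, Real.norm_eq_abs] at h2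
    rw [sub_zero]
    exact (hg n y).trans ((le_abs_self _).trans h2.le)
  have h := hS (Metric.closedBall 0 ‖φ 0‖) Metric.isBounded_closedBall g 0
    (fun n => by simpa using hb n) (by simp) hlim
  rw [map_zero, tendsto_tauC_iff] at h
  rw [Metric.tendsto_nhds]
  intro ε hε
  refine (h ⟨{x}, isCompact_singleton⟩ ε hε).mono fun n hn => ?_
  rw [dist_zero_right, Real.norm_eq_abs, pointFunctional_apply]
  refine lt_of_le_of_lt ?_ hn
  simpa using abs_le_supSeminorm (K := ⟨{x}, isCompact_singleton⟩) (x := x)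
    (Set.mem_singleton x) (S (g n))

/-- A convergent subsequence of parameters in `[0, t₀] × K` suffices: orbits converge uniformly on
`K`, and the limit function is continuous. -/
theorem isUniformlyTight_pointFunctional [PolishSpace Ω] (hT : T ∈ semigroupClassF Ω) (t₀ : ℝ≥0)
    (K : Compacts Ω) :
    IsUniformlyTight fun p : Set.Icc 0 t₀ × (K : Set Ω) => pointFunctional (T p.1) p.2 := by
  obtain ⟨-, -, hcont, hseq⟩ := hT
  have : CompactSpace (K : Set Ω) := isCompact_iff_compactSpace.1 K.isCompact
  refine isUniformlyTight_of_seqCompact (fun p => (hseq _).isSigmaSmooth _) fun u => ?_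
  let := upgradeIsCompletelyMetrizable Ω
  obtain ⟨q, σ, hσ, hq⟩ := CompactSpace.tendsto_subseq u
  refine ⟨q, σ, hσ, fun f => ?_⟩
  have h1 : Tendsto (fun n => ((u (σ n)).1 : ℝ≥0)) atTop (𝓝 q.1) :=
    (continuous_subtype_val.comp continuous_fst).continuousAt.tendsto.comp hq
  have h2 : Tendsto (fun n => ((u (σ n)).2 : Ω)) atTop (𝓝 q.2) :=
    (continuous_subtype_val.comp continuous_snd).continuousAt.tendsto.comp hq
  have h3 := (isStronglyContinuous_iff.1 hcont f q.1).comp h1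
  rw [tendsto_tauC_iff] at h3
  have h4 : Tendsto (fun n => T (u (σ n)).1 f (u (σ n)).2 - T q.1 f (u (σ n)).2) atTop (𝓝 0) := by
    rw [Metric.tendsto_nhds]
    intro ε hε
    refine (h3 K ε hε).mono fun n hn => ?_
    rw [dist_zero_right, Real.norm_eq_abs]
    exact (abs_le_supSeminorm (u (σ n)).2.2 (T (u (σ n)).1 f - T q.1 f)).trans_lt hn
  have h5 := h4.add (((T q.1 f).continuous.tendsto _).comp h2)
  simpa [pointFunctional_apply] using h5

theorem isLocallyEquicontinuous_of_mem_semigroupClassF [PolishSpace Ω] (hT : T ∈ semigroupClassF Ω) :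
    IsLocallyEquicontinuous (strictTopology Ω) T := by
  rw [isLocallyEquicontinuous_iff]
  intro t₀
  rw [tendsto_strictTopology_iff]
  intro q ε hε
  obtain ⟨M, hM⟩ := hT.2.1 t₀
  have hM' : ∀ (n : ℕ) (p : Set.Icc 0 t₀ × (q.1.1 n : Set Ω)) (f : Ω →ᵇ ℝ),
      |pointFunctional (T p.1) p.2 f| ≤ M * ‖f‖ := fun n p f =>
    ((T p.1 f).norm_coe_le_norm _).trans (hM _ p.1.2.2 f)
  obtain ⟨A, hA⟩ := q.2.2.bddAbove_range
  obtain ⟨q', C, hC, hq'⟩ := (IsUniformlyTight.sigma_smul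
    (fun n => isUniformlyTight_pointFunctional hT t₀ (q.1.1 n)) hM' q.2.1
    q.2.2).exists_le_strictSeminorm (M := A * |M|) (by
      rintro ⟨n, p⟩ f
      have h1 : q.1.2 n ≤ A := hA ⟨n, rfl⟩
      simp only [LinearMap.smul_apply, smul_eq_mul, abs_mul, abs_of_nonneg (q.2.1 n)]
      rw [mul_assoc]
      refine mul_le_mul h1 ((hM' n p f).trans ?_) (abs_nonneg _) ((q.2.1 n).trans h1)
      exact mul_le_mul_of_nonneg_right (le_abs_self M) (norm_nonneg f))
  have hbound : ∀ t ≤ t₀, ∀ f, strictSeminorm q (T t f) ≤ C * strictSeminorm q' f := by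
    intro t ht f
    have h0 : 0 ≤ C * strictSeminorm q' f := mul_nonneg hC.le (apply_nonneg _ _)
    refine strictSeminorm_le fun n => ?_
    rcases (q.2.1 n).eq_or_lt with ha | ha
    · rw [← ha, zero_mul]
      exact h0
    · rw [← le_div_iff₀' ha]
      refine supSeminorm_le (div_nonneg h0 ha.le) fun x hx => ?_
      rw [le_div_iff₀' ha]
      have h1 := hq' ⟨n, ⟨⟨t, zero_le, ht⟩, ⟨x, hx⟩⟩⟩ f
      simpa [abs_mul, abs_of_pos ha, pointFunctional_apply] using h1
  have hev := tendsto_strictTopology_iff.1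
    (tendsto_id (x := @nhds (Ω →ᵇ ℝ) (strictTopology Ω) 0)) q' (ε / C) (div_pos hε hC)
  rw [eventually_prod_principal_iff]
  refine hev.mono fun f hf t ht => ?_
  rw [id, sub_zero, lt_div_iff₀' hC] at hf
  rw [sub_zero]
  exact (hbound t ht f).trans_lt hf

/-- A bounded `τ_c`-null sequence is `β₀`-null, so `β₀`-equicontinuity applies, and `β₀` is finer
than `τ_c`. -/
theorem isLocallyBiEquicontinuous_of_mem_semigroupClassF [PolishSpace Ω] (hT : T ∈ semigroupClassF Ω) :
    IsLocallyBiEquicontinuous (tauC Ω) T := by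
  rw [isLocallyBiEquicontinuous_iff]
  intro u hu hu0 t₀
  obtain ⟨C, hC⟩ := isBounded_iff_forall_norm_le.1 hu
  have h1 := tendsto_strictTopology_of_tendsto_tauC (C := C)
    (Eventually.of_forall fun n => hC _ ⟨n, rfl⟩) hu0
  have h2 := isLocallyEquicontinuous_iff.1
    (isLocallyEquicontinuous_of_mem_semigroupClassF hT) t₀
  exact tendsto_tauC_of_tendsto_strictTopology
    (h2.comp ((h1.comp tendsto_fst).prodMk tendsto_snd))

theorem isStronglyContinuous_strictTopology_of_mem_semigroupClassF (hT : T ∈ semigroupClassF Ω) :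
    IsStronglyContinuous (strictTopology Ω) T := by
  rw [isStronglyContinuous_iff]
  intro f t
  obtain ⟨M, hM⟩ := hT.2.1 (t + 1)
  refine tendsto_strictTopology_of_tendsto_tauC (C := M * ‖f‖) ?_
    (isStronglyContinuous_iff.1 hT.2.2.1 f t)
  filter_upwards [Iic_mem_nhds (show t < t + 1 from lt_add_one t)] with s hs
  exact hM s hs f

/-! ### The converse inclusions -/

theorem IsOperatorSemigroup.isLocallyNormBounded {X : Type*} [NormedAddCommGroup X]
    [NormedSpace ℝ X] {T : ℝ≥0 → X →ₗ[ℝ] X} (hT : IsOperatorSemigroup T)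
    (hb : ∃ M : ℝ, ∀ t ≤ (1 : ℝ≥0), ∀ x : X, ‖T t x‖ ≤ M * ‖x‖) : IsLocallyNormBounded T := by
  obtain ⟨M, hM⟩ := hb
  have hM' : ∀ t ≤ (1 : ℝ≥0), ∀ x : X, ‖T t x‖ ≤ max M 1 * ‖x‖ := fun t ht x =>
    (hM t ht x).trans (mul_le_mul_of_nonneg_right (le_max_left _ _) (norm_nonneg x))
  have hM0 : 1 ≤ max M 1 := le_max_right _ _
  have key : ∀ n : ℕ, ∀ t ≤ (n : ℝ≥0), ∀ x : X, ‖T t x‖ ≤ max M 1 ^ n * ‖x‖ := by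
    intro n
    induction n with
    | zero =>
      intro t ht x
      have : t = 0 := le_antisymm (by simpa using ht) zero_le
      simp [this, hT.map_zero]
    | succ n ih =>
      intro t ht x
      -- Truncated subtraction covers `t < 1` as well.
      have h1 : t = min t 1 + (t - 1) := by
        rw [add_comm]; exact tsub_add_min.symm
      have h2 : t - 1 ≤ (n : ℝ≥0) := tsub_le_iff_right.2 (by simpa using ht)
      rw [h1, hT.map_add, LinearMap.comp_apply, pow_succ']
      refine (hM' _ (min_le_right _ _) _).trans ?_
      rw [mul_assoc]
      exact mul_le_mul_of_nonneg_left (ih _ h2 x) (zero_le_one.trans hM0)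
  intro t₀
  obtain ⟨n, hn⟩ := exists_nat_ge t₀
  exact ⟨max M 1 ^ n, fun t ht x => key n t (ht.trans hn) x⟩

theorem IsLocallyBiEquicontinuous.isSeqContinuousOnBounded
    (hT : IsLocallyBiEquicontinuous (tauC Ω) T) (t : ℝ≥0) :
    IsSeqContinuousOnBounded (tauC Ω) (T t) := by
  intro B hB u f hu hf hlim
  rw [← tendsto_tauC_sub_iff] at hlim ⊢
  have hb : Bornology.IsBounded (Set.range fun n => u n - f) := by
    refine (hB.sub hB).subset ?_
    rintro _ ⟨n, rfl⟩
    exact Set.sub_mem_sub (hu n) hf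
  intro U hU
  rw [mem_map]
  filter_upwards [hT _ hb hlim t U hU] with n hn
  have := hn t le_rfl
  rwa [map_sub] at this

/-- A locally equicontinuous family for the strict topology is locally norm-bounded, since the
strict topology has the same bounded sets as the norm. -/
theorem IsLocallyEquicontinuous.isLocallyNormBounded
    (hT : IsLocallyEquicontinuous (strictTopology Ω) T) : IsLocallyNormBounded T := by
  intro t₀
  by_contra! H
  -- One factor `n + 1` pays for the weight `1 / (n + 1)` of the singleton `{x n}` in `q`; the other
  -- makes the seminorm unbounded on a small norm ball.
  have H' : ∀ n : ℕ, ∃ t ≤ t₀, ∃ f : Ω →ᵇ ℝ, ∃ x, ((n : ℝ) + 1) ^ 2 * ‖f‖ < |T t f x| := by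
    intro n
    obtain ⟨t, ht, f, hf⟩ := H (((n : ℝ) + 1) ^ 2)
    refine ⟨t, ht, f, ?_⟩
    by_contra! h
    exact not_lt.2 (((T t f).norm_le (by positivity)).2 h) hf
  choose t ht f x hx using H'
  let q : StrictIndex Ω := ⟨(fun n => ⟨{x n}, isCompact_singleton⟩, fun n => 1 / ((n : ℝ) + 1)),
    fun n => by positivity, tendsto_one_div_add_atTop_nhds_zero_nat⟩
  have h1 := tendsto_strictTopology_iff.1 (isLocallyEquicontinuous_iff.1 hT t₀) q 1 one_pos
  rw [eventually_prod_principal_iff] at h1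
  obtain ⟨δ, hδ, hball⟩ := Metric.eventually_nhds_iff.1
    (h1.filter_mono nhds_zero_le_nhds_strictTopology)
  obtain ⟨n, hn⟩ := exists_nat_gt (2 / δ)
  have hf0 : 0 < ‖f n‖ := by
    rw [norm_pos_iff]
    intro h
    have := hx n
    simp [h] at this
  have hn0 : (0 : ℝ) < n + 1 := by positivity
  set c : ℝ := δ / 2 / ‖f n‖ with hc
  have hc0 : 0 < c := by positivity
  have h2 : strictSeminorm q (T (t n) (c • f n) - 0) < 1 := by
    refine hball ?_ (t n) (ht n)
    rw [dist_zero_right, norm_smul, Real.norm_eq_abs, abs_of_pos hc0, hc,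
      div_mul_cancel₀ _ hf0.ne']
    exact half_lt_self hδ
  rw [sub_zero, map_smul, map_smul_eq_mul, Real.norm_eq_abs, abs_of_pos hc0] at h2
  have h3 : 1 / ((n : ℝ) + 1) * |T (t n) (f n) (x n)| ≤ strictSeminorm q (T (t n) (f n)) :=
    (mul_le_mul_of_nonneg_left (abs_le_supSeminorm (K := ⟨{x n}, isCompact_singleton⟩)
      (Set.mem_singleton (x n)) _) (by positivity)).trans
      (mul_supSeminorm_le_strictSeminorm q n _)
  have h4 : ((n : ℝ) + 1) * ‖f n‖ < strictSeminorm q (T (t n) (f n)) := by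
    refine lt_of_lt_of_le ?_ h3
    rw [one_div, lt_inv_mul_iff₀ hn0]
    exact (le_of_eq (by ring)).trans_lt (hx n)
  have h5 := (mul_lt_mul_of_pos_left h4 hc0).trans h2
  have h6 : c * (((n : ℝ) + 1) * ‖f n‖) = δ / 2 * (n + 1) := by
    rw [hc]; field_simp
  rw [div_lt_iff₀ hδ] at hn
  rw [h6] at h5
  nlinarith

theorem IsLocallyEquicontinuous.isSeqContinuousOnBounded
    (hT : IsLocallyEquicontinuous (strictTopology Ω) T) (t : ℝ≥0) :
    IsSeqContinuousOnBounded (tauC Ω) (T t) := by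
  intro B hB u f hu _ hlim
  obtain ⟨C, hC⟩ := isBounded_iff_forall_norm_le.1 hB
  have h1 := tendsto_strictTopology_of_tendsto_tauC
    (Eventually.of_forall fun n => hC _ (hu n)) hlim
  rw [← tendsto_strictTopology_sub_iff] at h1
  refine tendsto_tauC_of_tendsto_strictTopology (tendsto_strictTopology_sub_iff.1 ?_)
  intro U hU
  obtain ⟨V, hV, hVU⟩ := hT t U hU
  rw [mem_map]
  filter_upwards [mem_map.1 (h1 hV)] with n hn
  have := hVU t le_rfl _ hn
  rwa [map_sub] at this

end Semigroup

theorem theorem3p4 (Ω : Type*) [TopologicalSpace Ω] [PolishSpace Ω] :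
    { T : ℝ≥0 → (Ω →ᵇ ℝ) →ₗ[ℝ] (Ω →ᵇ ℝ) | IsBiContinuousSemigroup (tauC Ω) T } =
        semigroupClassF Ω ∧
    { T : ℝ≥0 → (Ω →ᵇ ℝ) →ₗ[ℝ] (Ω →ᵇ ℝ) | IsOperatorSemigroup T ∧
        IsStronglyContinuous (strictTopology Ω) T ∧
        IsLocallyEquicontinuous (strictTopology Ω) T } =
        semigroupClassF Ω := by
  refine ⟨Set.Subset.antisymm (fun T hT => ?_) (fun T hT => ?_),
    Set.Subset.antisymm (fun T hT => ?_) (fun T hT => ?_)⟩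
  · exact ⟨hT.semigroup, hT.semigroup.isLocallyNormBounded hT.bounded_unitInterval,
      hT.stronglyContinuous, hT.locallyBiEquicontinuous.isSeqContinuousOnBounded⟩
  · exact ⟨hT.1, fun t => (hT.2.1 t).imp fun M hM => hM t le_rfl, hT.2.2.1, hT.2.1 1,
      isLocallyBiEquicontinuous_of_mem_semigroupClassF hT⟩
  · obtain ⟨h1, h2, h3⟩ := hT
    exact ⟨h1, h3.isLocallyNormBounded, isStronglyContinuous_iff.2 fun f t =>
      tendsto_tauC_of_tendsto_strictTopology (isStronglyContinuous_iff.1 h2 f t),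
      h3.isSeqContinuousOnBounded⟩
  · exact ⟨hT.1, isStronglyContinuous_strictTopology_of_mem_semigroupClassF hT,
      isLocallyEquicontinuous_of_mem_semigroupClassF hT⟩
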